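/- Let $g\in C^3(\mathbb{R})$ be a shock similarity profile, that is, a solution of $$(g g')''=\tfrac13\, g' z\quad\text{on }\mathbb{R},\qquad g(z)\to 1\ (z\to-\infty),\qquad g(z)\to-1\ (z\to+\infty).$$ For $t<0$ put $u_-(x,t)=g\big(x/(-t)^{1/3}\big)$, and let $S_-(x)=-\operatorname{sign}x$. Then: (i) $g-1\notin L^1((-\infty,0))$, and $u_-(\cdot,t)-S_-\notin L^1(\mathbb{R})$ for every $t<0$; in particular $u_-(\cdot,t)$ does not converge to $S_-$ in $L^1(\mathbb{R})$ as $t\to0^-$. (ii) $u_-(\cdot,t)\to S_-$ in $L^1_{\rm loc}(\mathbb{R})$ as $t\to 0^-$, at the rate $(-t)^{1/12}$: for every compact $K\subset\mathbb{R}$ there is a constant $C=C(g,K)>0$ such that $$\int_K|u_-(x,t)-S_-(x)|\,dx\le C\,(-t)^{1/12}$$ for all $t<0$ sufficiently close to $0$. -/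

import Mathlib

open Set Filter Topology MeasureTheory

/-- `g` is a shock similarity profile: a classical solution on `ℝ` of the problem
`(g g')'' = (1/3) g' z`, `g(-∞) = 1`, `g(+∞) = -1`. -/
structure IsShockProfile (g : ℝ → ℝ) : Prop where
  contDiff : ContDiff ℝ 3 g
  ode : ∀ z : ℝ, iteratedDeriv 2 (fun y : ℝ => g y * deriv g y) z = 1 / 3 * deriv g z * z
  tendsto_atBot : Tendsto g atBot (𝓝 1)
  tendsto_atTop : Tendsto g atTop (𝓝 (-1))

/-- The similarity solution `u₋(x,t) = g(x / (-t)^{1/3})`, of interest for `t < 0`.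
The time is the first argument, so that `uMinus g t` is the function `x ↦ u₋(x,t)`. -/
noncomputable def uMinus (g : ℝ → ℝ) (t x : ℝ) : ℝ :=
  g (x / (-t) ^ (1 / 3 : ℝ))

/-- The shock `S₋(x) = -sign x`. -/
noncomputable def SMinus (x : ℝ) : ℝ := -Real.sign x

/-- `u(·,t) → v` in `L¹(ℝ)` as `t → 0⁻`. -/
def ConvergesInL1 (u : ℝ → ℝ → ℝ) (v : ℝ → ℝ) : Prop :=
  Tendsto (fun t : ℝ => eLpNorm (fun x : ℝ => u t x - v x) 1 volume) (𝓝[<] 0) (𝓝 0)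

/-- `u(·,t) → v` in `L¹_loc(ℝ)` as `t → 0⁻`: convergence in `L¹(K)` for every compact `K ⊆ ℝ`. -/
def ConvergesInL1Loc (u : ℝ → ℝ → ℝ) (v : ℝ → ℝ) : Prop :=
  ∀ K : Set ℝ, IsCompact K →
    Tendsto (fun t : ℝ => eLpNorm (fun x : ℝ => u t x - v x) 1 (volume.restrict K))
      (𝓝[<] 0) (𝓝 0)

/-! The functions `-g(s)` and `g(-s)` are both profile tails, so each end of the shock reduces to
one problem at `+∞`.

Decay: along a tail `E = tailEnergy` is comparable to `q² + s v²`, and `E' = v²/6 - q³/(2s²)`. Hence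
`E/s` decreases and `q = O(√s)`. The first integral `J = q + s(f - 1)/3`, with `J' = (f - 1)/3`,
turns this into `f - 1 = O(s^(-1/2))`. The weaker exponent `-1/4` already gives the rate: with `z =
x/(-t)^(1/3)`, `|z|^(-1/4) = (-t)^(1/12) |x|^(-1/4)`, and `|x|^(-1/4)` is locally integrable.

Non-integrability: the energy is positive (otherwise `f` would be constant back to where it equals
`1/2`) and stays bounded below, since its possible loss rate is integrable. If `f - 1` were
integrable, `J` would be bounded, and the virial identity of `mul_sqrt_tailEnergy_le` on `[S, 2S]`
would make the energy too small for large `S`. Scaling carries this to `u₋ - S₋`, and convergence in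
`L¹` would force integrability. -/

/-- One end of a shock profile in the variable `s → +∞`: the limit of `f` is normalised to `1`,
`p = f'`, `v = f f'`, `q = v'`, and `q' = -(s / 3) f'`. -/
structure IsProfileTail (f p v q : ℝ → ℝ) : Prop where
  hasDerivAt_f : ∀ s, HasDerivAt f (p s) s
  v_eq : ∀ s, v s = f s * p s
  hasDerivAt_v : ∀ s, HasDerivAt v (q s) s
  hasDerivAt_q : ∀ s, HasDerivAt q (-(s / 3) * p s) s
  tendsto_f : Tendsto f atTop (𝓝 1)

/-- The smallness conditions under which the energy of a profile tail is coercive on `[a, ∞)`. -/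
structure IsTailStart (f q : ℝ → ℝ) (a : ℝ) : Prop where
  one_le : 1 ≤ a
  le_f : ∀ s, a ≤ s → 3 / 4 ≤ f s
  f_le : ∀ s, a ≤ s → f s ≤ 5 / 4
  abs_q_le : ∀ s, a ≤ s → |q s| ≤ s / 4

/-- The energy of a profile tail. The cubic term removes the cubic part of the derivative of the
quadratic energy `f q² / 2 + s v² / 6`. -/
noncomputable def tailEnergy (f v q : ℝ → ℝ) (s : ℝ) : ℝ :=
  f s * q s ^ 2 / 2 + s * v s ^ 2 / 6 + q s ^ 3 / (2 * s)

theorem monotoneOn_of_hasDerivAt_nonneg {F F' : ℝ → ℝ} {D : Set ℝ} (hD : Convex ℝ D)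
    (h : ∀ x ∈ D, HasDerivAt F (F' x) x) (h0 : ∀ x ∈ D, 0 ≤ F' x) : MonotoneOn F D :=
  monotoneOn_of_deriv_nonneg hD (fun x hx => (h x hx).continuousAt.continuousWithinAt)
    (fun x hx => (h x (interior_subset hx)).differentiableAt.differentiableWithinAt)
    (fun x hx => by rw [(h x (interior_subset hx)).deriv]; exact h0 x (interior_subset hx))

theorem antitoneOn_of_hasDerivAt_nonpos {F F' : ℝ → ℝ} {D : Set ℝ} (hD : Convex ℝ D)
    (h : ∀ x ∈ D, HasDerivAt F (F' x) x) (h0 : ∀ x ∈ D, F' x ≤ 0) : AntitoneOn F D :=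
  antitoneOn_of_deriv_nonpos hD (fun x hx => (h x hx).continuousAt.continuousWithinAt)
    (fun x hx => (h x (interior_subset hx)).differentiableAt.differentiableWithinAt)
    (fun x hx => by rw [(h x (interior_subset hx)).deriv]; exact h0 x (interior_subset hx))

theorem hasDerivAt_inv_sqrt {s : ℝ} (hs : 0 < s) :
    HasDerivAt (fun s => (√s)⁻¹) (-(1 / (2 * s * √s))) s := by
  have h := (Real.hasDerivAt_sqrt hs.ne').inv (Real.sqrt_pos.2 hs).ne'
  refine h.congr_deriv ?_
  rw [Real.sq_sqrt hs.le]
  have := (Real.sqrt_pos.2 hs).ne'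
  field_simp

/-! ### First integral and energy identity -/

namespace IsProfileTail

variable {f p v q : ℝ → ℝ}

theorem hasDerivAt_firstIntegral (h : IsProfileTail f p v q) (s : ℝ) :
    HasDerivAt (fun s => q s + s * (f s - 1) / 3) ((f s - 1) / 3) s := by
  have := (h.hasDerivAt_q s).add
    (((hasDerivAt_id s).mul ((h.hasDerivAt_f s).sub_const 1)).div_const 3)
  refine this.congr_deriv ?_
  simp only [id]
  ring

/-- Since `J' = (f - 1)/3 → 0`, `J = o(s)`; also `s(f - 1) = o(s)`, hence `q = o(s)`. -/
theorem eventually_abs_q_le (h : IsProfileTail f p v q) {ε : ℝ} (hε : 0 < ε) :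
    ∀ᶠ s in atTop, |q s| ≤ ε * s := by
  have h1 : ∀ᶠ s in atTop, |f s - 1| ≤ ε := by
    have := h.tendsto_f (Metric.closedBall_mem_nhds 1 hε)
    simpa [Real.dist_eq] using this
  obtain ⟨a, ha⟩ := eventually_atTop.1 (h1.and (eventually_ge_atTop 0))
  set J : ℝ → ℝ := fun s => q s + s * (f s - 1) / 3 with hJ
  have hJb : ∀ s, a ≤ s → |J s - J a| ≤ ε / 3 * (s - a) := by
    intro s hs
    have := (convex_Ici a).norm_image_sub_le_of_norm_hasDerivWithin_le
      (f := J) (f' := fun s => (f s - 1) / 3) (C := ε / 3)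
      (fun x _ => (h.hasDerivAt_firstIntegral x).hasDerivWithinAt)
      (fun x hx => by
        rw [Real.norm_eq_abs, abs_div, abs_of_pos (by norm_num : (0 : ℝ) < 3)]
        have := (ha x hx).1
        linarith) (self_mem_Ici (a := a)) hs
    rwa [Real.norm_eq_abs, Real.norm_eq_abs, abs_of_nonneg (sub_nonneg.2 hs)] at this
  filter_upwards [eventually_ge_atTop a, eventually_ge_atTop (3 * |J a| / ε)] with s hs hs'
  obtain ⟨hf, h0⟩ := ha s hs
  have ha0 := (ha a le_rfl).2
  have h2 := hJb s hs
  have h3 : |s * (f s - 1) / 3| ≤ s * ε / 3 := by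
    rw [abs_div, abs_mul, abs_of_nonneg h0, abs_of_pos (by norm_num : (0 : ℝ) < 3)]
    gcongr
  have h4 : 3 * |J a| ≤ s * ε := (div_le_iff₀ hε).1 hs'
  have h5 : q s = (J s - J a) + J a - s * (f s - 1) / 3 := by simp only [hJ]; ring
  have h6 : |q s| ≤ |J s - J a| + |J a| + |s * (f s - 1) / 3| := by
    rw [h5]
    exact (abs_sub _ _).trans (add_le_add_left (abs_add_le _ _) _)
  nlinarith [mul_nonneg hε.le ha0]

theorem exists_isTailStart (h : IsProfileTail f p v q) : ∃ a, IsTailStart f q a := by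
  have h1 : ∀ᶠ s in atTop, |f s - 1| ≤ 1 / 4 := by
    have := h.tendsto_f (Metric.closedBall_mem_nhds 1 (by norm_num : (0 : ℝ) < 1 / 4))
    simpa [Real.dist_eq] using this
  obtain ⟨a, ha⟩ := eventually_atTop.1 ((h1.and (h.eventually_abs_q_le
    (by norm_num : (0 : ℝ) < 1 / 4))).and (eventually_ge_atTop 1))
  refine ⟨a, (ha a le_rfl).2, fun s hs => ?_, fun s hs => ?_, fun s hs => ?_⟩
  · linarith [(abs_le.1 (ha s hs).1.1).1]
  · linarith [(abs_le.1 (ha s hs).1.1).2]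
  · linarith [(ha s hs).1.2]

/-- The cross terms `∓ s v q/3` cancel because `v = f p`, and the terms `± p q²/2` cancel by the
cubic correction. -/
theorem hasDerivAt_tailEnergy (h : IsProfileTail f p v q) {s : ℝ} (hs : 0 < s) :
    HasDerivAt (tailEnergy f v q) (v s ^ 2 / 6 - q s ^ 3 / (2 * s ^ 2)) s := by
  have hq := h.hasDerivAt_q s
  have := ((((h.hasDerivAt_f s).mul (hq.pow 2)).div_const 2).add
    (((hasDerivAt_id s).mul ((h.hasDerivAt_v s).pow 2)).div_const 6)).add
    ((hq.pow 3).div ((hasDerivAt_id s).const_mul 2) (by simpa using hs.ne'))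
  refine this.congr_deriv ?_
  simp only [id, Pi.pow_apply, h.v_eq]
  have := hs.ne'
  field_simp
  ring

end IsProfileTail

/-! ### Coercivity of the energy and decay of the tail -/

section Energy

variable {f p v q : ℝ → ℝ} {a s : ℝ}

theorem IsTailStart.abs_cube_le (ha : IsTailStart f q a) (hs : a ≤ s) :
    |q s ^ 3| ≤ s / 4 * q s ^ 2 := by
  rw [pow_succ, abs_mul, abs_of_nonneg (sq_nonneg _), mul_comm]
  exact mul_le_mul_of_nonneg_right (ha.abs_q_le s hs) (sq_nonneg _)

theorem IsTailStart.le_tailEnergy (ha : IsTailStart f q a) (hs : a ≤ s) :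
    q s ^ 2 / 4 + s * v s ^ 2 / 6 ≤ tailEnergy f v q s := by
  have hs0 : 0 < s := by linarith [ha.one_le]
  have h1 : -(q s ^ 2 / 8) ≤ q s ^ 3 / (2 * s) := by
    rw [le_div_iff₀ (by positivity)]
    nlinarith [(abs_le.1 (ha.abs_cube_le hs)).1]
  have := mul_le_mul_of_nonneg_right (ha.le_f s hs) (sq_nonneg (q s))
  unfold tailEnergy
  linarith

theorem IsTailStart.tailEnergy_le (ha : IsTailStart f q a) (hs : a ≤ s) :
    tailEnergy f v q s ≤ q s ^ 2 + s * v s ^ 2 / 6 := by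
  have hs0 : 0 < s := by linarith [ha.one_le]
  have h1 : q s ^ 3 / (2 * s) ≤ q s ^ 2 / 8 := by
    rw [div_le_iff₀ (by positivity)]
    nlinarith [(abs_le.1 (ha.abs_cube_le hs)).2]
  have := mul_le_mul_of_nonneg_right (ha.f_le s hs) (sq_nonneg (q s))
  unfold tailEnergy
  linarith [sq_nonneg (q s)]

theorem IsTailStart.tailEnergy_nonneg (ha : IsTailStart f q a) (hs : a ≤ s) :
    0 ≤ tailEnergy f v q s := by
  have hs0 : 0 < s := by linarith [ha.one_le]
  exact le_trans (by positivity) (ha.le_tailEnergy hs)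

namespace IsProfileTail

/-- The energy grows at most linearly. -/
theorem antitoneOn_tailEnergy_div (h : IsProfileTail f p v q) (ha : IsTailStart f q a) :
    AntitoneOn (fun s => tailEnergy f v q s / s) (Ici a) := by
  refine antitoneOn_of_hasDerivAt_nonpos (convex_Ici a)
    (fun s hs => (h.hasDerivAt_tailEnergy ?_).div (hasDerivAt_id s) ?_) ?_
  · exact lt_of_lt_of_le (by linarith [ha.one_le]) hs
  · exact (lt_of_lt_of_le (by linarith [ha.one_le]) hs : 0 < s).ne'
  · intro s hs
    have hs0 : 0 < s := lt_of_lt_of_le (by linarith [ha.one_le]) hs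
    refine div_nonpos_of_nonpos_of_nonneg ?_ (by positivity)
    -- In `s E' - E` the terms `s v²/6` cancel, leaving at most `q²/8 - q²/4`.
    have h1 := ha.le_tailEnergy (v := v) hs
    have h2 : -(q s ^ 3 / (2 * s ^ 2)) * s ≤ q s ^ 2 / 8 := by
      have : -(q s ^ 3 / (2 * s ^ 2)) * s = -q s ^ 3 / (2 * s) := by field_simp
      rw [this, div_le_iff₀ (by positivity)]
      nlinarith [(abs_le.1 (ha.abs_cube_le hs)).1]
    nlinarith [sq_nonneg (q s)]

theorem exists_abs_q_le_sqrt (h : IsProfileTail f p v q) (ha : IsTailStart f q a) :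
    ∃ D, 0 < D ∧ ∀ s, a ≤ s → |q s| ≤ D * √s := by
  have ha1 := ha.one_le
  have hE : 0 ≤ tailEnergy f v q a := ha.tailEnergy_nonneg le_rfl
  refine ⟨√(4 * tailEnergy f v q a / a + 1), Real.sqrt_pos.2 (by positivity), fun s hs => ?_⟩
  have hs0 : 0 < s := by linarith
  rw [← Real.sqrt_mul (by positivity)]
  refine Real.abs_le_sqrt ?_
  have h1 := h.antitoneOn_tailEnergy_div ha self_mem_Ici hs hs
  simp only at h1
  rw [div_le_iff₀ hs0] at h1
  have h2 := ha.le_tailEnergy (v := v) hs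
  have h3 : 0 ≤ s * v s ^ 2 / 6 := by positivity
  have h4 : (4 * tailEnergy f v q a / a + 1) * s = 4 * (tailEnergy f v q a / a * s) + s := by ring
  rw [h4]
  linarith

/-- The decay rate of the tail. -/
theorem exists_abs_sub_one_le (h : IsProfileTail f p v q) :
    ∃ a, 1 ≤ a ∧ ∃ C, ∀ s, a ≤ s → |f s - 1| ≤ C * (√s)⁻¹ := by
  obtain ⟨a, ha⟩ := h.exists_isTailStart
  obtain ⟨D, hD, hq⟩ := h.exists_abs_q_le_sqrt ha
  have ha1 := ha.one_le
  -- `K = 3J/s`: the terms in `p` cancel in `K'`, which is therefore `O(s^(-3/2))` and can be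
  -- integrated from infinity.
  set K : ℝ → ℝ := fun s => f s - 1 + 3 * (q s / s) with hK
  have hK' : ∀ s, a ≤ s → HasDerivAt K (-3 * q s / s ^ 2) s := by
    intro s hs
    have hs0 : s ≠ 0 := by linarith
    have := ((h.hasDerivAt_f s).sub_const 1).add
      (((h.hasDerivAt_q s).div (hasDerivAt_id s) hs0).const_mul 3)
    refine this.congr_deriv ?_
    simp only [id]
    field_simp
    ring
  have hsq : Tendsto (fun s : ℝ => (√s)⁻¹) atTop (𝓝 0) :=
    tendsto_inv_atTop_zero.comp Real.tendsto_sqrt_atTop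
  have hqs : ∀ s, a ≤ s → |q s / s| ≤ D * (√s)⁻¹ := by
    intro s hs
    have hs0 : 0 < s := by linarith
    rw [abs_div, abs_of_pos hs0, div_le_iff₀ hs0]
    refine (hq s hs).trans (le_of_eq ?_)
    have := Real.mul_self_sqrt hs0.le
    have h3 := (Real.sqrt_pos.2 hs0).ne'
    field_simp
    linarith
  have hlim : Tendsto K atTop (𝓝 0) := by
    have h1 : Tendsto (fun s => q s / s) atTop (𝓝 0) := by
      refine squeeze_zero_norm' ?_ (by simpa using hsq.const_mul D)
      filter_upwards [eventually_ge_atTop a] with s hs using hqs s hs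
    simpa using (h.tendsto_f.sub_const 1).add (h1.const_mul 3)
  have hbound : ∀ s, a ≤ s → |-3 * q s / s ^ 2| ≤ 6 * D * (1 / (2 * s * √s)) := by
    intro s hs
    have hs0 : 0 < s := by linarith
    have : -3 * q s / s ^ 2 = -3 / s * (q s / s) := by field_simp
    rw [this, abs_mul, abs_div, abs_of_pos hs0]
    calc |(-3 : ℝ)| / s * |q s / s| ≤ |(-3 : ℝ)| / s * (D * (√s)⁻¹) := by gcongr; exact hqs s hs
      _ = 6 * D * (1 / (2 * s * √s)) := by norm_num; field_simp; norm_num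
  have hpos : ∀ s, a ≤ s → 0 < s := fun s hs => by linarith
  have hle : ∀ s, a ≤ s → K s ≤ 6 * D * (√s)⁻¹ := by
    have hm : MonotoneOn (fun s => K s - 6 * D * (√s)⁻¹) (Ici a) :=
      monotoneOn_of_hasDerivAt_nonneg (convex_Ici a)
        (fun s hs => (hK' s hs).sub ((hasDerivAt_inv_sqrt (hpos s hs)).const_mul _))
        (fun s hs => by linarith [(abs_le.1 (hbound s hs)).1])
    have hl : Tendsto (fun s => K s - 6 * D * (√s)⁻¹) atTop (𝓝 0) := by
      simpa using hlim.sub (hsq.const_mul (6 * D))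
    intro s hs
    have := ge_of_tendsto hl (by
      filter_upwards [eventually_ge_atTop s] with t ht using hm hs (mem_Ici.2 (hs.trans ht)) ht)
    simpa using this
  have hge : ∀ s, a ≤ s → -(6 * D * (√s)⁻¹) ≤ K s := by
    have hm : AntitoneOn (fun s => K s + 6 * D * (√s)⁻¹) (Ici a) :=
      antitoneOn_of_hasDerivAt_nonpos (convex_Ici a)
        (fun s hs => (hK' s hs).add ((hasDerivAt_inv_sqrt (hpos s hs)).const_mul _))
        (fun s hs => by linarith [(abs_le.1 (hbound s hs)).2])
    have hl : Tendsto (fun s => K s + 6 * D * (√s)⁻¹) atTop (𝓝 0) := by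
      simpa using hlim.add (hsq.const_mul (6 * D))
    intro s hs
    have := le_of_tendsto hl (by
      filter_upwards [eventually_ge_atTop s] with t ht using hm hs (mem_Ici.2 (hs.trans ht)) ht)
    simp only at this
    linarith
  refine ⟨a, ha1, 9 * D, fun s hs => ?_⟩
  have h1 := abs_le.1 (hqs s hs)
  have h2 := hle s hs
  have h3 := hge s hs
  simp only [hK] at h2 h3
  exact abs_le.2 ⟨by linarith, by linarith⟩

end IsProfileTail

end Energy

/-! ### Energy lower bound and non-integrability -/

namespace IsProfileTail

variable {f p v q : ℝ → ℝ} {a : ℝ}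

/-- The energy cannot drop by more than a fixed factor. -/
theorem exists_mul_tailEnergy_le (h : IsProfileTail f p v q) (ha : IsTailStart f q a) :
    ∃ m, 0 < m ∧ ∀ s t, a ≤ s → s ≤ t → m * tailEnergy f v q s ≤ tailEnergy f v q t := by
  obtain ⟨D, hD, hq⟩ := h.exists_abs_q_le_sqrt ha
  have ha1 := ha.one_le
  have hpos : ∀ s, a ≤ s → 0 < s := fun s hs => by linarith
  -- Integrating factor for `E' ≥ -(2D s^(-3/2)) E`, which follows from `|q| ≤ D√s` and `q² ≤ 4E`.
  have hm : MonotoneOn (fun s => tailEnergy f v q s * Real.exp (-(4 * D) * (√s)⁻¹)) (Ici a) := by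
    refine monotoneOn_of_hasDerivAt_nonneg (convex_Ici a)
      (fun s hs => (h.hasDerivAt_tailEnergy (hpos s hs)).mul
        ((hasDerivAt_inv_sqrt (hpos s hs)).const_mul (-(4 * D))).exp) fun s hs => ?_
    have hs0 := hpos s hs
    have hr := Real.sqrt_pos.2 hs0
    have hr2 := Real.mul_self_sqrt hs0.le
    have h1 := ha.le_tailEnergy (v := v) hs
    have h2 : q s ^ 3 / (2 * s ^ 2) ≤ D / (2 * s * √s) * q s ^ 2 := by
      have : D / (2 * s * √s) * q s ^ 2 = D * √s * q s ^ 2 / (2 * s ^ 2) := by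
        rw [div_mul_eq_mul_div, div_eq_div_iff (by positivity) (by positivity)]
        linear_combination (-(2 * D * q s ^ 2 * s)) * hr2
      rw [this]
      gcongr
      rw [pow_succ, mul_comm]
      exact mul_le_mul_of_nonneg_right ((le_abs_self _).trans (hq s hs)) (sq_nonneg _)
    have h3 : D / (2 * s * √s) * q s ^ 2 ≤ D / (2 * s * √s) * (4 * tailEnergy f v q s) := by
      gcongr
      nlinarith [mul_nonneg hs0.le (sq_nonneg (v s))]
    have h4 : 0 ≤ v s ^ 2 / 6 - q s ^ 3 / (2 * s ^ 2) +
        tailEnergy f v q s * (-(4 * D) * -(1 / (2 * s * √s))) := by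
      have : tailEnergy f v q s * (-(4 * D) * -(1 / (2 * s * √s))) =
        D / (2 * s * √s) * (4 * tailEnergy f v q s) := by ring
      rw [this]
      linarith [sq_nonneg (v s)]
    calc (0 : ℝ) ≤ _ := mul_nonneg (Real.exp_pos (-(4 * D) * (√s)⁻¹)).le h4
      _ = _ := by ring
  refine ⟨Real.exp (-(4 * D)), Real.exp_pos _, fun s t hs hst => ?_⟩
  have ht := hs.trans hst
  have h1 := hm hs ht hst
  simp only at h1
  calc Real.exp (-(4 * D)) * tailEnergy f v q s
      ≤ Real.exp (-(4 * D) * (√s)⁻¹) * tailEnergy f v q s := by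
        refine mul_le_mul_of_nonneg_right (Real.exp_le_exp.2 ?_) (ha.tailEnergy_nonneg hs)
        have : (√s)⁻¹ ≤ 1 := inv_le_one_of_one_le₀ (Real.one_le_sqrt.2 (by linarith))
        nlinarith
    _ ≤ tailEnergy f v q t * Real.exp (-(4 * D) * (√t)⁻¹) := by rw [mul_comm]; exact h1
    _ ≤ tailEnergy f v q t * 1 := by
        refine mul_le_mul_of_nonneg_left (Real.exp_le_one_iff.2 ?_) (ha.tailEnergy_nonneg ht)
        have : 0 ≤ (√t)⁻¹ := by positivity
        nlinarith
    _ = _ := mul_one _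

/-- A profile tail with zero Cauchy data `(v, q)` is constant as long as `f` stays positive. -/
theorem eq_of_cauchyData_eq_zero (h : IsProfileTail f p v q) {b : ℝ} (hba : b ≤ a)
    (hf : ∀ s ∈ Icc b a, 1 / 2 ≤ f s) (hv : v a = 0) (hq : q a = 0) : f b = f a := by
  set M := |b| + |a| with hM
  -- Backward Grönwall: `f ≥ 1/2` gives `|p| ≤ 2|v|`, so the system for `(v, q)` has bounded
  -- coefficients on `[b, a]`.
  have hN : MonotoneOn (fun s => Real.exp ((1 + M) * s) * (v s ^ 2 + q s ^ 2)) (Icc b a) := by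
    refine monotoneOn_of_hasDerivAt_nonneg (convex_Icc b a)
      (fun s _ => (((hasDerivAt_id s).const_mul (1 + M)).exp).mul
        (((h.hasDerivAt_v s).pow 2).add ((h.hasDerivAt_q s).pow 2))) fun s hs => ?_
    have hfs := hf s hs
    have hsM : |s| ≤ M := by
      rw [hM]
      exact abs_le.2 ⟨by linarith [hs.1, neg_abs_le b, abs_nonneg a],
        by linarith [hs.2, le_abs_self a, abs_nonneg b]⟩
    have hp : |p s| ≤ 2 * |v s| := by
      rw [h.v_eq, abs_mul, abs_of_nonneg (by linarith : 0 ≤ f s)]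
      nlinarith [abs_nonneg (p s)]
    have hvq : 2 * (|v s| * |q s|) ≤ v s ^ 2 + q s ^ 2 := by
      rw [← sq_abs (v s), ← sq_abs (q s)]
      nlinarith [sq_nonneg (|v s| - |q s|)]
    have h1 : -(|v s| * |q s|) ≤ v s * q s := by
      rw [← abs_mul]; exact neg_abs_le _
    have h2 : s * p s * q s ≤ M * (2 * |v s|) * |q s| := by
      refine (le_abs_self _).trans ?_
      rw [abs_mul, abs_mul]
      gcongr
    have hM0 : 0 ≤ M := by positivity
    have h3 : 0 ≤ (1 + M) * (v s ^ 2 + q s ^ 2) + (2 * (v s * q s) - 2 / 3 * (s * p s * q s)) := by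
      nlinarith [mul_le_mul_of_nonneg_left hvq hM0, mul_nonneg (abs_nonneg (v s)) (abs_nonneg (q s)),
        mul_nonneg hM0 (mul_nonneg (abs_nonneg (v s)) (abs_nonneg (q s)))]
    calc (0 : ℝ) ≤ _ := mul_nonneg (Real.exp_pos ((1 + M) * s)).le h3
      _ = _ := by simp only [id]; push_cast; ring
  have hp : ∀ s ∈ Icc b a, p s = 0 := by
    intro s hs
    have h1 := hN hs (right_mem_Icc.2 hba) hs.2
    simp only [hv, hq] at h1
    have h2 : v s ^ 2 + q s ^ 2 ≤ 0 := by
      refine nonpos_of_mul_nonpos_right (b := v s ^ 2 + q s ^ 2) (h1.trans (by simp))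
        (Real.exp_pos _)
    have h3 : v s = 0 := by nlinarith [sq_nonneg (v s), sq_nonneg (q s)]
    rw [h.v_eq] at h3
    exact (mul_eq_zero.1 h3).resolve_left (by linarith [hf s hs])
  have hl := left_mem_Icc.2 hba
  have hr := right_mem_Icc.2 hba
  exact le_antisymm
    (monotoneOn_of_hasDerivAt_nonneg (convex_Icc b a) (fun s _ => h.hasDerivAt_f s)
      (fun s hs => (hp s hs).ge) hl hr hba)
    (antitoneOn_of_hasDerivAt_nonpos (convex_Icc b a) (fun s _ => h.hasDerivAt_f s)
      (fun s hs => (hp s hs).le) hl hr hba)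

theorem tailEnergy_pos (h : IsProfileTail f p v q) (hbot : Tendsto f atBot (𝓝 (-1)))
    (ha : IsTailStart f q a) : 0 < tailEnergy f v q a := by
  by_contra! hE
  have ha1 := ha.one_le
  have hfa := ha.le_f a le_rfl
  have h1 := (ha.le_tailEnergy (v := v) le_rfl).trans hE
  have hv2 : 0 ≤ a * v a ^ 2 := by positivity
  have hq : q a = 0 := by nlinarith [sq_nonneg (q a)]
  have hv : v a = 0 := by nlinarith [sq_nonneg (q a), sq_nonneg (v a)]
  have hc : Continuous f := continuous_iff_continuousAt.2 fun s => (h.hasDerivAt_f s).continuousAt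
  have hivt : ∀ s, s ≤ a → f s ≤ 1 / 2 → ∃ x ∈ Icc s a, f x = 1 / 2 := fun s hs hfs =>
    intermediate_value_Icc hs hc.continuousOn ⟨hfs, by linarith⟩
  set Z : Set ℝ := {s | s ≤ a ∧ f s = 1 / 2} with hZ
  have hZc : IsClosed Z :=
    (isClosed_le continuous_id continuous_const).inter (isClosed_eq hc continuous_const)
  have hZb : BddAbove Z := ⟨a, fun s hs => hs.1⟩
  have hZn : Z.Nonempty := by
    obtain ⟨s, hs, hs'⟩ := ((hbot.eventually_le_const (by norm_num : (-1 : ℝ) < 1 / 2)).and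
      (eventually_le_atBot a)).exists
    obtain ⟨x, hx, hfx⟩ := hivt s hs' hs
    exact ⟨x, hx.2, hfx⟩
  -- At the last point before `a` where `f = 1/2`, uniqueness would give `f = f a ≥ 3/4`.
  obtain ⟨hba, hfb⟩ := hZc.csSup_mem hZn hZb
  have := h.eq_of_cauchyData_eq_zero hba (fun s hs => ?_) hv hq
  · linarith
  · by_contra! hlt
    obtain ⟨x, hx, hfx⟩ := hivt s hs.2 hlt.le
    have hxs : x ≤ s := (le_csSup hZb ⟨hx.2, hfx⟩).trans hs.1
    have : x = s := le_antisymm hxs hx.1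
    subst this
    linarith

/-- The mass of `|f - 1|` on `[S, 2S]` controls the energy at `S`. -/
theorem mul_sqrt_tailEnergy_le (h : IsProfileTail f p v q) (ha : IsTailStart f q a) {m : ℝ}
    (hm : ∀ s t, a ≤ s → s ≤ t → m * tailEnergy f v q s ≤ tailEnergy f v q t) {A : ℝ → ℝ}
    (hA : ∀ s, HasDerivAt A |f s - 1| s) {B : ℝ}
    (hB : ∀ s, a ≤ s → |q s + s * (f s - 1) / 3| ≤ B) {S : ℝ} (hS : a ≤ S)
    (hE : 0 < tailEnergy f v q S) :
    m * √(tailEnergy f v q S) * S ≤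
      16 * B + 24 * √(tailEnergy f v q S) + 20 / 3 * S * (A (2 * S) - A S) := by
  have ha1 := ha.one_le
  have hS0 : 0 < S := by linarith
  set e := tailEnergy f v q S with he
  set r := √e with hr
  have hr0 : 0 < r := Real.sqrt_pos.2 hE
  have hre : r ^ 2 = e := Real.sq_sqrt hE.le
  set J : ℝ → ℝ := fun s => q s + s * (f s - 1) / 3 with hJ
  have hEle : ∀ s ∈ Icc S (2 * S), tailEnergy f v q s ≤ 2 * e := by
    intro s hs
    have h1 := h.antitoneOn_tailEnergy_div ha hS (hS.trans hs.1) hs.1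
    simp only at h1
    have hs0 : 0 < s := by linarith [hs.1]
    rw [div_le_div_iff₀ hs0 hS0] at h1
    have h2 := mul_le_mul_of_nonneg_left hs.2 hE.le
    exact le_of_mul_le_mul_right (by linarith) hS0
  have hq : ∀ s ∈ Icc S (2 * S), |q s| ≤ 3 * r := by
    intro s hs
    have h1 := ha.le_tailEnergy (v := v) (hS.trans hs.1)
    have h2 : 0 ≤ s * v s ^ 2 := mul_nonneg (by linarith [hs.1]) (sq_nonneg _)
    exact abs_le_of_sq_le_sq (by nlinarith [hEle s hs]) (by positivity)
  have hv : ∀ s ∈ Icc S (2 * S), |v s| ≤ 4 * r := by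
    intro s hs
    have h1 := ha.le_tailEnergy (v := v) (hS.trans hs.1)
    have h2 : v s ^ 2 ≤ s * v s ^ 2 := le_mul_of_one_le_left (sq_nonneg _) (by linarith [hs.1])
    exact abs_le_of_sq_le_sq (by nlinarith [hEle s hs, sq_nonneg (q s)]) (by positivity)
  -- Virial functional: `Φ' = q² + s v p/3 + (2/3)(v + s q)(f - 1)`, whose first two terms dominate
  -- the energy. Written with `J`, `Φ` is bounded without a factor `s`.
  set Φ : ℝ → ℝ := fun s => 2 * (v s * J s) - v s * q s with hΦ
  have hΦb : ∀ s ∈ Icc S (2 * S), |Φ s| ≤ 4 * r * (2 * B + 3 * r) := by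
    intro s hs
    have : Φ s = v s * (2 * J s - q s) := by simp only [hΦ]; ring
    rw [this, abs_mul]
    have h1 : |2 * J s - q s| ≤ 2 * B + 3 * r := by
      refine (abs_sub _ _).trans (add_le_add ?_ (hq s hs))
      rw [abs_mul, abs_two]
      exact mul_le_mul_of_nonneg_left (hB s (hS.trans hs.1)) (by norm_num)
    exact mul_le_mul (hv s hs) h1 (abs_nonneg _) (by positivity)
  have hmono : MonotoneOn (fun s => Φ s + 20 / 3 * (r * S) * A s - m * e * s) (Icc S (2 * S)) := by
    refine monotoneOn_of_hasDerivAt_nonneg (convex_Icc _ _)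
      (fun s _ => (((((h.hasDerivAt_v s).mul (h.hasDerivAt_firstIntegral s)).const_mul 2).sub
        ((h.hasDerivAt_v s).mul (h.hasDerivAt_q s))).add ((hA s).const_mul _)).sub
        ((hasDerivAt_id s).const_mul (m * e))) fun s hs => ?_
    have has := hS.trans hs.1
    have hs0 : 0 < s := by linarith
    have h1 : m * e ≤ q s ^ 2 + s * v s ^ 2 / 6 := (hm S s hS hs.1).trans (ha.tailEnergy_le has)
    have h2 : v s ^ 2 / 2 ≤ v s * p s := by
      have : v s ^ 2 / 2 = f s * (f s * p s ^ 2) / 2 := by rw [h.v_eq]; ring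
      rw [this, h.v_eq]
      have hf0 := ha.le_f s has
      have : 0 ≤ f s * p s ^ 2 := mul_nonneg (by linarith) (sq_nonneg _)
      nlinarith [ha.f_le s has]
    have h3 : |(v s + s * q s) * (f s - 1)| ≤ 10 * (r * S) * |f s - 1| := by
      rw [abs_mul]
      refine mul_le_mul_of_nonneg_right ?_ (abs_nonneg _)
      refine (abs_add_le _ _).trans ?_
      rw [abs_mul, abs_of_pos hs0]
      have h4 : s * |q s| ≤ 2 * S * (3 * r) :=
        mul_le_mul hs.2 (hq s hs) (abs_nonneg _) (by positivity)
      have h5 : r ≤ r * S := le_mul_of_one_le_right hr0.le (by linarith)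
      linarith [hv s hs]
    have h4 := (abs_le.1 h3).1
    have h5 := mul_le_mul_of_nonneg_left h2 hs0.le
    have h6 : 0 ≤ q s ^ 2 + s * (v s * p s) / 3 + 2 / 3 * ((v s + s * q s) * (f s - 1)) +
      20 / 3 * (r * S) * |f s - 1| - m * e := by linarith
    calc (0 : ℝ) ≤ _ := h6
      _ = _ := by ring
  have hl : S ∈ Icc S (2 * S) := ⟨le_rfl, by linarith⟩
  have hu : 2 * S ∈ Icc S (2 * S) := ⟨by linarith, le_rfl⟩
  have h1 := hmono hl hu hu.1
  simp only at h1
  have h2 := (abs_le.1 (hΦb S hl)).1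
  have h3 := (abs_le.1 (hΦb _ hu)).2
  refine le_of_mul_le_mul_right (a := r) ?_ hr0
  rw [← hre] at h1
  nlinarith

/-- The deviation of a nontrivial profile tail from its limit is not integrable. -/
theorem not_integrableOn_sub_one (h : IsProfileTail f p v q) (hbot : Tendsto f atBot (𝓝 (-1))) :
    ¬ IntegrableOn (fun s => f s - 1) (Ioi 0) := by
  intro hint
  obtain ⟨a, ha⟩ := h.exists_isTailStart
  obtain ⟨m, hm0, hm⟩ := h.exists_mul_tailEnergy_le ha
  have ha1 := ha.one_le
  have hEa := h.tailEnergy_pos hbot ha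
  have hc : Continuous fun s => |f s - 1| :=
    ((continuous_iff_continuousAt.2 fun s => (h.hasDerivAt_f s).continuousAt).sub
      continuous_const).abs
  set A : ℝ → ℝ := fun s => ∫ x in (0 : ℝ)..s, |f x - 1| with hAdef
  have hA : ∀ s, HasDerivAt A |f s - 1| s := fun s => (hc.integral_hasStrictDerivAt 0 s).hasDerivAt
  obtain ⟨L, hL⟩ : ∃ L, Tendsto A atTop (𝓝 L) :=
    ⟨_, intervalIntegral_tendsto_integral_Ioi 0 hint.abs tendsto_id⟩
  have hAmono : Monotone A :=
    monotone_of_hasDerivAt_nonneg hA fun s => abs_nonneg _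
  have hAL : ∀ s, A s ≤ L := hAmono.ge_of_tendsto hL
  obtain ⟨B, hB⟩ : ∃ B, ∀ s, a ≤ s → |q s + s * (f s - 1) / 3| ≤ B := by
    refine ⟨|q a + a * (f a - 1) / 3| + (L - A a), fun s hs => ?_⟩
    have h1 := monotoneOn_of_hasDerivAt_nonneg convex_univ
      (fun x _ => (h.hasDerivAt_firstIntegral x).add (hA x))
      (fun x _ => by linarith [neg_abs_le (f x - 1), abs_nonneg (f x - 1)])
      (mem_univ a) (mem_univ s) hs
    have h2 := antitoneOn_of_hasDerivAt_nonpos convex_univ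
      (fun x _ => (h.hasDerivAt_firstIntegral x).sub (hA x))
      (fun x _ => by linarith [le_abs_self (f x - 1), abs_nonneg (f x - 1)])
      (mem_univ a) (mem_univ s) hs
    simp only [Pi.add_apply, Pi.sub_apply] at h1 h2
    exact abs_le.2 ⟨by linarith [hAL s, neg_abs_le (q a + a * (f a - 1) / 3)],
      by linarith [hAL s, le_abs_self (q a + a * (f a - 1) / 3)]⟩
  set c := √(m * tailEnergy f v q a) with hcdef
  have hc0 : 0 < c := Real.sqrt_pos.2 (by positivity)
  have hdiff : Tendsto (fun S => A (2 * S) - A S) atTop (𝓝 0) := by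
    simpa using (hL.comp (tendsto_id.const_mul_atTop (by norm_num : (0 : ℝ) < 2))).sub hL
  -- The thresholds make each of the three terms on the right of `mul_sqrt_tailEnergy_le` at most a
  -- quarter of the left side.
  obtain ⟨S, ⟨⟨hS1, hS2⟩, hS3⟩, hS4⟩ :=
    ((((eventually_ge_atTop a).and (eventually_ge_atTop (96 / m))).and
      (eventually_ge_atTop (64 * B / (m * c)))).and
      (hdiff.eventually_le_const (by positivity : 0 < m * c / 28))).exists
  have hS0 : 0 < S := by linarith
  have hES := hm a S le_rfl hS1
  have hmain := h.mul_sqrt_tailEnergy_le ha hm hA hB hS1 (by nlinarith)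
  have hcr : c ≤ √(tailEnergy f v q S) := Real.sqrt_le_sqrt hES
  set r := √(tailEnergy f v q S)
  have hmS : 0 < m * S := by positivity
  rw [div_le_iff₀ hm0] at hS2
  rw [div_le_iff₀ (by positivity)] at hS3
  nlinarith [mul_le_mul_of_nonneg_left hcr hmS.le, mul_le_mul_of_nonneg_left hS4 hS0.le]

end IsProfileTail

theorem IsProfileTail.exists_abs_sub_one_le_rpow {f p v q : ℝ → ℝ} (h : IsProfileTail f p v q) :
    ∃ M, ∀ s, 0 < s → |f s - 1| ≤ M * s ^ (-(1 / 4) : ℝ) := by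
  obtain ⟨a, ha1, C, hC⟩ := h.exists_abs_sub_one_le
  have ha0 : 0 < a := by linarith
  have hc : Continuous fun s => f s - 1 :=
    (continuous_iff_continuousAt.2 fun s => (h.hasDerivAt_f s).continuousAt).sub continuous_const
  obtain ⟨B, hB⟩ := (isCompact_Icc (a := (0 : ℝ)) (b := a)).exists_bound_of_continuousOn
    hc.continuousOn
  have hB0 : 0 ≤ B := (norm_nonneg _).trans (hB a (right_mem_Icc.2 ha0.le))
  refine ⟨B * a ^ (1 / 4 : ℝ) + |C|, fun s hs => ?_⟩
  have hs4 : 0 < s ^ (-(1 / 4) : ℝ) := Real.rpow_pos_of_pos hs _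
  have ha4 : 0 < a ^ (1 / 4 : ℝ) := Real.rpow_pos_of_pos ha0 _
  rw [add_mul]
  rcases le_total s a with hsa | hsa
  · have h1 : 1 ≤ a ^ (1 / 4 : ℝ) * s ^ (-(1 / 4) : ℝ) := by
      rw [Real.rpow_neg hs.le, ← div_eq_mul_inv, one_le_div (Real.rpow_pos_of_pos hs _)]
      exact Real.rpow_le_rpow hs.le hsa (by norm_num)
    have h2 := hB s ⟨hs.le, hsa⟩
    rw [Real.norm_eq_abs] at h2
    have h3 := mul_le_mul_of_nonneg_left h1 hB0
    have h4 : 0 ≤ |C| * s ^ (-(1 / 4) : ℝ) := by positivity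
    linarith
  · have h1 : (√s)⁻¹ ≤ s ^ (-(1 / 4) : ℝ) := by
      rw [Real.sqrt_eq_rpow, ← Real.rpow_neg hs.le]
      exact Real.rpow_le_rpow_of_exponent_le (by linarith) (by norm_num)
    calc |f s - 1| ≤ C * (√s)⁻¹ := hC s hsa
      _ ≤ |C| * (√s)⁻¹ := by gcongr; exact le_abs_self C
      _ ≤ |C| * s ^ (-(1 / 4) : ℝ) := by gcongr
      _ ≤ _ := le_add_of_nonneg_left (by positivity)

/-! ### From tails to the shock profile -/

namespace IsShockProfile

variable {g : ℝ → ℝ}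

theorem hasDerivAt_g (hg : IsShockProfile g) (z : ℝ) : HasDerivAt g (deriv g z) z :=
  (hg.contDiff.differentiable (by norm_num) z).hasDerivAt

theorem contDiff_flux (hg : IsShockProfile g) : ContDiff ℝ 2 fun y => g y * deriv g y :=
  (hg.contDiff.of_le (by norm_num)).mul (hg.contDiff.iterate_deriv' 2 1)

theorem hasDerivAt_flux (hg : IsShockProfile g) (z : ℝ) :
    HasDerivAt (fun y => g y * deriv g y) (deriv (fun y => g y * deriv g y) z) z :=
  (hg.contDiff_flux.differentiable (by norm_num) z).hasDerivAt

theorem hasDerivAt_deriv_flux (hg : IsShockProfile g) (z : ℝ) :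
    HasDerivAt (deriv fun y => g y * deriv g y) (1 / 3 * deriv g z * z) z := by
  have h1 : Differentiable ℝ (deriv fun y => g y * deriv g y) :=
    (hg.contDiff_flux.iterate_deriv' 1 1).differentiable (by norm_num)
  rw [← hg.ode z, iteratedDeriv_succ, iteratedDeriv_one]
  exact (h1 z).hasDerivAt

theorem isProfileTail_neg (hg : IsShockProfile g) :
    IsProfileTail (fun s => -g s) (fun s => -deriv g s) (fun s => g s * deriv g s)
      (deriv fun y => g y * deriv g y) where
  hasDerivAt_f s := (hg.hasDerivAt_g s).neg
  v_eq s := by ring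
  hasDerivAt_v := hg.hasDerivAt_flux
  hasDerivAt_q s := (hg.hasDerivAt_deriv_flux s).congr_deriv (by ring)
  tendsto_f := by simpa using hg.tendsto_atTop.neg

theorem isProfileTail_comp_neg (hg : IsShockProfile g) :
    IsProfileTail (fun s => g (-s)) (fun s => -deriv g (-s)) (fun s => -(g (-s) * deriv g (-s)))
      (fun s => deriv (fun y => g y * deriv g y) (-s)) where
  hasDerivAt_f s := ((hg.hasDerivAt_g (-s)).comp s (hasDerivAt_neg s)).congr_deriv (by ring)
  v_eq s := by ring
  hasDerivAt_v s :=
    ((hg.hasDerivAt_flux (-s)).comp s (hasDerivAt_neg s)).neg.congr_deriv (by ring)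
  hasDerivAt_q s :=
    ((hg.hasDerivAt_deriv_flux (-s)).comp s (hasDerivAt_neg s)).congr_deriv (by ring)
  tendsto_f := hg.tendsto_atBot.comp tendsto_neg_atTop_atBot

theorem not_integrableOn_sub_one (hg : IsShockProfile g) :
    ¬ IntegrableOn (fun z => g z - 1) (Iio 0) := by
  intro hint
  refine hg.isProfileTail_comp_neg.not_integrableOn_sub_one
    (hg.tendsto_atTop.comp tendsto_neg_atBot_atTop) ?_
  have := ((Measure.measurePreserving_neg (volume : Measure ℝ)).integrableOn_comp_preimage
    (Homeomorph.neg ℝ).measurableEmbedding).2 hint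
  simpa [Function.comp_def] using this

theorem exists_abs_sub_SMinus_le (hg : IsShockProfile g) :
    ∃ M, ∀ z, z ≠ 0 → |g z - SMinus z| ≤ M * |z| ^ (-(1 / 4) : ℝ) := by
  obtain ⟨M₁, h₁⟩ := hg.isProfileTail_neg.exists_abs_sub_one_le_rpow
  obtain ⟨M₂, h₂⟩ := hg.isProfileTail_comp_neg.exists_abs_sub_one_le_rpow
  refine ⟨max M₁ M₂, fun z hz => ?_⟩
  have hpos : 0 ≤ |z| ^ (-(1 / 4) : ℝ) := by positivity
  rcases hz.lt_or_gt with hz | hz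
  · have := h₂ (-z) (by linarith)
    rw [neg_neg, ← abs_of_neg hz] at this
    rw [SMinus, Real.sign_of_neg hz, neg_neg]
    exact this.trans (mul_le_mul_of_nonneg_right (le_max_right _ _) hpos)
  · have := h₁ z hz
    rw [← abs_of_pos hz, abs_of_pos hz, ← abs_neg] at this
    rw [SMinus, Real.sign_of_pos hz, abs_of_pos hz]
    refine le_trans (le_of_eq ?_) (this.trans
      (mul_le_mul_of_nonneg_right (le_max_left _ _) (by positivity)))
    congr 1
    ring

end IsShockProfile

/-! ### Scaling to the similarity solution -/

theorem SMinus_mul_of_pos {c : ℝ} (hc : 0 < c) (x : ℝ) : SMinus (c * x) = SMinus x := by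
  unfold SMinus
  rcases lt_trichotomy x 0 with hx | rfl | hx
  · rw [Real.sign_of_neg hx, Real.sign_of_neg (mul_neg_of_pos_of_neg hc hx)]
  · rw [mul_zero]
  · rw [Real.sign_of_pos hx, Real.sign_of_pos (mul_pos hc hx)]

theorem measurable_SMinus : Measurable SMinus := by
  unfold SMinus Real.sign
  exact (Measurable.ite measurableSet_Iio measurable_const
    (Measurable.ite measurableSet_Ioi measurable_const measurable_const)).neg

namespace IsShockProfile

variable {g : ℝ → ℝ} {t : ℝ}

theorem not_integrable_uMinus_sub_SMinus (hg : IsShockProfile g) (ht : t < 0) :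
    ¬ Integrable (fun x => uMinus g t x - SMinus x) := by
  intro hint
  have hτ : 0 < (-t) ^ (1 / 3 : ℝ) := Real.rpow_pos_of_pos (by linarith) _
  have h1 := hint.comp_mul_left' hτ.ne'
  refine hg.not_integrableOn_sub_one ((h1.integrableOn (s := Iio 0)).congr_fun ?_ measurableSet_Iio)
  intro x hx
  have hx0 : x < 0 := hx
  simp only [uMinus, SMinus_mul_of_pos hτ, mul_div_cancel_left₀ x hτ.ne']
  rw [SMinus, Real.sign_of_neg hx0, neg_neg]

theorem not_convergesInL1 (hg : IsShockProfile g) : ¬ ConvergesInL1 (uMinus g) SMinus := by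
  intro hconv
  obtain ⟨t, ht1, ht⟩ := ((hconv.eventually_lt_const (u := ⊤) ENNReal.zero_lt_top).and
    self_mem_nhdsWithin).exists
  refine hg.not_integrable_uMinus_sub_SMinus ht (memLp_one_iff_integrable.1 ⟨?_, ht1⟩)
  have hc : Continuous (uMinus g t) :=
    hg.contDiff.continuous.comp (continuous_id.div_const _)
  exact (hc.measurable.sub measurable_SMinus).aestronglyMeasurable

/-- The pointwise form of the convergence rate. -/
theorem exists_abs_uMinus_sub_SMinus_le (hg : IsShockProfile g) :
    ∃ M, ∀ t < 0, ∀ x, x ≠ 0 →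
      |uMinus g t x - SMinus x| ≤ M * (-t) ^ (1 / 12 : ℝ) * |x| ^ (-(1 / 4) : ℝ) := by
  obtain ⟨M, hM⟩ := hg.exists_abs_sub_SMinus_le
  refine ⟨M, fun t ht x hx => ?_⟩
  have ht0 : 0 < -t := by linarith
  set τ := (-t) ^ (1 / 3 : ℝ) with hτdef
  have hτ : 0 < τ := Real.rpow_pos_of_pos ht0 _
  have h1 := hM (x / τ) (div_ne_zero hx hτ.ne')
  have h2 : SMinus (x / τ) = SMinus x := by
    rw [div_eq_inv_mul, SMinus_mul_of_pos (inv_pos.2 hτ)]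
  have h3 : |x / τ| ^ (-(1 / 4) : ℝ) = (-t) ^ (1 / 12 : ℝ) * |x| ^ (-(1 / 4) : ℝ) := by
    rw [abs_div, abs_of_pos hτ, Real.div_rpow (abs_nonneg x) hτ.le, div_eq_inv_mul,
      ← Real.rpow_neg hτ.le, hτdef, ← Real.rpow_mul ht0.le]
    norm_num
  rw [h2, h3, ← mul_assoc] at h1
  exact h1

theorem exists_eLpNorm_uMinus_sub_SMinus_le (hg : IsShockProfile g) {K : Set ℝ}
    (hK : IsCompact K) : ∃ C : ℝ, 0 < C ∧ ∀ t < 0,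
      eLpNorm (fun x => uMinus g t x - SMinus x) 1 (volume.restrict K) ≤
        ENNReal.ofReal (C * (-t) ^ (1 / 12 : ℝ)) := by
  obtain ⟨M, hM⟩ := hg.exists_abs_uMinus_sub_SMinus_le
  set w : ℝ → ℝ := fun x => |x| ^ (-(1 / 4) : ℝ) with hw
  have hwK : IntegrableOn w K := by
    have hloc : LocallyIntegrable w := by
      refine locallyIntegrable_of_norm_le_rpow (C := 1) (α := 1 / 4) (by simp) (by norm_num)
        (Eventually.of_forall fun x => ?_) ?_
      · rw [one_mul, Real.norm_of_nonneg (by positivity), Real.norm_eq_abs]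
      · exact (continuous_abs.measurable.pow_const _).aestronglyMeasurable
    exact hloc.integrableOn_isCompact hK
  have hfin : eLpNorm w 1 (volume.restrict K) ≠ ⊤ := (memLp_one_iff_integrable.2 hwK).2.ne
  -- The `+ 1` only ensures positivity, for instance when `K` is null.
  refine ⟨|M| * (eLpNorm w 1 (volume.restrict K)).toReal + 1, by positivity, fun t ht => ?_⟩
  have hr : 0 ≤ (-t) ^ (1 / 12 : ℝ) := Real.rpow_nonneg (by linarith) _
  calc eLpNorm (fun x => uMinus g t x - SMinus x) 1 (volume.restrict K)
      ≤ eLpNorm ((M * (-t) ^ (1 / 12 : ℝ)) • w) 1 (volume.restrict K) := by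
        refine eLpNorm_mono_ae_real (ae_restrict_of_ae ?_)
        filter_upwards [Measure.ae_ne volume (0 : ℝ)] with x hx using hM t ht x hx
    _ = ENNReal.ofReal (|M| * (-t) ^ (1 / 12 : ℝ)) *
          ENNReal.ofReal (eLpNorm w 1 (volume.restrict K)).toReal := by
        rw [eLpNorm_const_smul, ENNReal.ofReal_toReal hfin, Real.enorm_eq_ofReal_abs, abs_mul,
          abs_of_nonneg hr]
    _ = ENNReal.ofReal (|M| * (-t) ^ (1 / 12 : ℝ) *
          (eLpNorm w 1 (volume.restrict K)).toReal) :=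
        (ENNReal.ofReal_mul (by positivity)).symm
    _ ≤ _ := ENNReal.ofReal_le_ofReal (by linarith)

theorem convergesInL1Loc (hg : IsShockProfile g) : ConvergesInL1Loc (uMinus g) SMinus := by
  intro K hK
  obtain ⟨C, -, hC⟩ := hg.exists_eLpNorm_uMinus_sub_SMinus_le hK
  have hc : Continuous fun t : ℝ => ENNReal.ofReal (C * (-t) ^ (1 / 12 : ℝ)) :=
    ENNReal.continuous_ofReal.comp
      ((continuous_neg.rpow_const fun _ => Or.inr (by norm_num)).const_mul C)
  have hlim := (hc.tendsto 0).mono_left (nhdsWithin_le_nhds (s := Iio 0))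
  rw [neg_zero, Real.zero_rpow (by norm_num), mul_zero, ENNReal.ofReal_zero] at hlim
  exact tendsto_of_tendsto_of_tendsto_of_le_of_le' tendsto_const_nhds hlim
    (Eventually.of_forall fun _ => zero_le)
    (by filter_upwards [self_mem_nhdsWithin] with t ht using hC t ht)

end IsShockProfile

theorem proposition3p2 (g : ℝ → ℝ) (hg : IsShockProfile g) :
    -- the tail of the profile, and the difference from the shock, are not integrable
    (¬ IntegrableOn (fun z : ℝ => g z - 1) (Iio 0) volume) ∧
    (∀ t : ℝ, t < 0 → ¬ Integrable (fun x : ℝ => uMinus g t x - SMinus x) volume) ∧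
    -- no convergence in `L¹(ℝ)`
    (¬ ConvergesInL1 (uMinus g) SMinus) ∧
    -- convergence in `L¹_loc(ℝ)`
    ConvergesInL1Loc (uMinus g) SMinus ∧
    -- the rate, with a constant that depends on `g` and the compact set only
    (∀ K : Set ℝ, IsCompact K → ∃ C : ℝ, 0 < C ∧ ∀ᶠ t in 𝓝[<] (0 : ℝ),
      eLpNorm (fun x : ℝ => uMinus g t x - SMinus x) 1 (volume.restrict K) ≤
        ENNReal.ofReal (C * (-t) ^ (1 / 12 : ℝ))) :=
  ⟨hg.not_integrableOn_sub_one, fun _ => hg.not_integrable_uMinus_sub_SMinus,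
    hg.not_convergesInL1, hg.convergesInL1Loc, fun K hK => by
      obtain ⟨C, hC0, hC⟩ := hg.exists_eLpNorm_uMinus_sub_SMinus_le hK
      exact ⟨C, hC0, by filter_upwards [self_mem_nhdsWithin] with t ht using hC t ht⟩⟩
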